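/- Theorem 6 (Impossibility of weak detection with partial correlation in $d$ dimensions). For integers $n,d\ge 1$, $0\le k\le n$ and $|\rho|\le 1$, let $\Sigma_\rho=\begin{pmatrix}1&\rho\\ \rho&1\end{pmatrix}$ and consider the following two laws of a pair $(X,Y)\in\mathbb{R}^{n\times d}\times\mathbb{R}^{n\times d}$ with rows $X_i,Y_i\in\mathbb{R}^d$. Under $\mathcal{H}_0$ all $2nd$ entries of $X$ and $Y$ are independent standard normal variables. Under $\mathcal{H}_1$ a uniformly random permutation $\sigma$ of $\{1,\dots,n\}$ and, independently, a uniformly random $k$-element subset $\mathcal{K}$ of $\{1,\dots,n\}$ are drawn; given $(\sigma,\mathcal{K})$ the pairs of rows $(X_i,Y_{\sigma(i)})$, $1\le i\le n$, are independent, and the $d$ coordinate pairs $(X_{ij},Y_{\sigma(i)j})$, $1\le j\le d$, are i.i.d. with law $\mathcal{N}(0,\Sigma_\rho)$ if $i\in\mathcal{K}$ and $\mathcal{N}(0,\Sigma_0)$ if $i\notin\mathcal{K}$. Let $$\mathsf{R}^\star=\inf_{\phi}\big(\mathbb{P}_{\mathcal{H}_0}[\phi(X,Y)=1]+\mathbb{P}_{\mathcal{H}_1}[\phi(X,Y)=0]\big),$$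 the infimum being over all (measurable) tests $\phi:\mathbb{R}^{n\times d}\times\mathbb{R}^{n\times d}\to\{0,1\}$. (i) If $\rho^2<1/d$, then $\mathbb{P}_{\mathcal{H}_1}$ is absolutely continuous with respect to $\mathbb{P}_{\mathcal{H}_0}$, and $\mathcal{L}=\frac{\mathrm{d}\mathbb{P}_{\mathcal{H}_1}}{\mathrm{d}\mathbb{P}_{\mathcal{H}_0}}$ satisfies $$\mathbb{E}_{\mathcal{H}_0}[\mathcal{L}(X,Y)^2]\le 1+\Big(\frac{k}{n}\Big)^2\Big(\prod_{i=1}^k\frac{1}{1-(d\rho^2)^i}-1\Big).$$ (ii) Let $(\rho,n,k,d)=(\rho_\ell,n_\ell,k_\ell,d_\ell)_{\ell}$ be any sequence of such parameters with $\rho_\ell^2<1/d_\ell$ for every $\ell$ and $$\Big(\frac{k_\ell}{n_\ell}\Big)^2\Big(\prod_{i=1}^{k_\ell}\frac{1}{1-(d_\ell\rho_\ell^2)^i}-1\Big)\longrightarrow 0\qquad(\ell\to\infty).$$ Then $\mathsf{R}^\star_\ell\to 1$ as $\ell\to\infty$. In particular weak detection is impossible: it is not the case that $\limsup_{\ell\to\infty}\mathsf{R}^\star_\ell<1$.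 -/

import Mathlib

open MeasureTheory ProbabilityTheory Filter Topology

noncomputable section

namespace CorrelatedDatabases

/-- A pair of databases `(X, Y)`, each with `n` rows in `ℝ^d`. -/
abbrev Databases (n d : ℕ) : Type := (Fin n → Fin d → ℝ) × (Fin n → Fin d → ℝ)

/-- The covariance matrix with unit variances and correlation `ρ`. -/
def corrMatrix (ρ : ℝ) : Matrix (Fin 2) (Fin 2) ℝ := !![1, ρ; ρ, 1]

/-- The centred bivariate normal distribution with covariance matrix `corrMatrix ρ`. -/
def pairLaw (ρ : ℝ) : Measure (EuclideanSpace ℝ (Fin 2)) :=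
  multivariateGaussian 0 (corrMatrix ρ)

/-- The databases `(X, Y)` in which row `X i` is paired with row `Y (σ i)`, the `j`-th coordinates
of these two rows being the two entries of `z i j`. -/
def assemble {n d : ℕ} (σ : Equiv.Perm (Fin n)) (z : Fin n → Fin d → EuclideanSpace ℝ (Fin 2)) :
    Databases n d :=
  (fun i j => z i j 0, fun i j => z (σ.symm i) j 1)

/-- The law of `(X, Y)` when the pairs of rows `(X i, Y (σ i))` are independent, the `d` coordinate
pairs of the `i`-th one being i.i.d. with correlation `r i`. -/
def pairedLaw (n d : ℕ) (σ : Equiv.Perm (Fin n)) (r : Fin n → ℝ) : Measure (Databases n d) :=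
  (Measure.pi fun i => Measure.pi fun _ : Fin d => pairLaw (r i)).map (assemble σ)

/-- The null hypothesis: the pairs `(X i, Y i)` are i.i.d. and all correlations vanish. -/
def nullLaw (n d : ℕ) : Measure (Databases n d) :=
  pairedLaw n d (Equiv.refl (Fin n)) fun _ => 0

/-- The law under the alternative given the permutation `σ` and the set `K` of correlated rows. -/
def condAltLaw (n d : ℕ) (ρ : ℝ) (σ : Equiv.Perm (Fin n)) (K : Finset (Fin n)) :
    Measure (Databases n d) :=
  pairedLaw n d σ fun i => if i ∈ K then ρ else 0

/-- The alternative hypothesis: the average of the conditional laws over a uniform permutation `σ`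
and an independent uniform `k`-element set `K` of rows. -/
def altLaw (n k d : ℕ) (ρ : ℝ) : Measure (Databases n d) :=
  ((n.factorial * n.choose k : ℕ) : ENNReal)⁻¹ •
    ∑ σ : Equiv.Perm (Fin n), ∑ K ∈ (Finset.univ : Finset (Fin n)).powersetCard k,
      condAltLaw n d ρ σ K

/-- The risk of a test: the sum of the type I and type II error probabilities. -/
def risk (n k d : ℕ) (ρ : ℝ) (φ : Databases n d → Fin 2) : ℝ :=
  (nullLaw n d).real {z | φ z = 1} + (altLaw n k d ρ).real {z | φ z = 0}

/-- The optimal risk: the infimum of the risk over all (measurable) tests. -/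
def optimalRisk (n k d : ℕ) (ρ : ℝ) : ℝ :=
  ⨅ φ : {φ : Databases n d → Fin 2 // Measurable φ}, risk n k d ρ φ.1

/-- A sequence of parameters is admissible for weak detection if the limit superior of the
optimal risks is less than one. -/
def AdmissibleForWeakDetection (n k d : ℕ → ℕ) (ρ : ℕ → ℝ) : Prop :=
  limsup (fun l => optimalRisk (n l) (k l) (d l) (ρ l)) atTop < 1

/-- The likelihood ratio of the alternative with respect to the null hypothesis. -/
def likelihoodRatio (n k d : ℕ) (ρ : ℝ) : Databases n d → ENNReal :=
  (altLaw n k d ρ).rnDeriv (nullLaw n d)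

/-- The quantity `(k/n)² (∏_{i=1}^k 1/(1 - (dρ²)^i) - 1)`. -/
def excess (n k d : ℕ) (ρ : ℝ) : ℝ :=
  ((k : ℝ) / n) ^ 2 * (∏ i ∈ Finset.Icc 1 k, 1 / (1 - ((d : ℝ) * ρ ^ 2) ^ i) - 1)

end CorrelatedDatabases

end

noncomputable section

namespace CorrelatedDatabases

open scoped ENNReal

/-! ### Product measures: Fubini and densities. -/

section Pi

variable {Ω : Type*} [MeasurableSpace Ω]

/-! The proof is a second-moment computation. The likelihood ratio is the average, over pairs `(σ,
K)`, of products of Mehler kernels `corrDensity`, so its second moment is an average over pairs `(σ,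
K)`, `(σ', K')`. Integrating out `Y` with the semigroup law of the kernel (correlations multiply)
leaves an integral over `X` of kernels along the edges `i → π i`, where `π = σ'⁻¹ * σ` and the
correlation of an edge is `ρ ^ 2` or `0` (`lintegral_pairedDensity_mul`).

Such an integral depends only on traces along the cycles of `π`. A cycle whose correlations multiply
to `r` contributes `(1 - r)⁻¹ ^ d`, which by Bernoulli is at most `(1 - d * r)⁻¹`, the trace of the
diagonal kernel on `ℕ` with entries `(d * r) ^ a`. `cycleIntegral_le` turns this into a comparison
without any cycle decomposition, by removing one vertex at a time. The second moment is thereby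
bounded by a sum over vectors `a : Fin n → ℕ` that are invariant under `π` and supported in `K ∩
K'`, with weight `x ^ (∑ i, a i)`, `x = d * ρ ^ 2`.

Summing over `σ, σ', K, K'` first gives each `a` the factor `n! * stabCard a * coverCard k a ^ 2`.
The vector `a = 0` produces the leading `1`. For `a ≠ 0`, `coverCard_le` yields the factor `(k / n)
^ 2`, and by orbit counting (`tsum_stabCard_le`) the remaining sum is bounded by the generating
function of partitions with at most `k` parts, `∏ (1 - x ^ i)⁻¹`, minus its constant term.

For the risk, a second moment near `1` forces the two laws to be close on every event
(`real_le_add_of_lintegral_sq_le`), so no test does asymptotically better than a constant one. -/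

lemma lintegral_pi_fin_succ {n : ℕ} (μ : Fin (n + 1) → Measure Ω) [∀ i, SigmaFinite (μ i)]
    {g : (Fin (n + 1) → Ω) → ℝ≥0∞} (hg : Measurable g) :
    ∫⁻ x, g x ∂(Measure.pi μ) =
      ∫⁻ y, ∫⁻ x, g (Fin.cons x y) ∂(μ 0) ∂(Measure.pi fun i => μ i.succ) := by
  have h := measurePreserving_piFinSuccAbove μ 0
  rw [← (h.symm).lintegral_comp hg]
  refine (lintegral_prod_symm
    (fun a => g ((MeasurableEquiv.piFinSuccAbove (fun _ => Ω) 0).symm a))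
    (hg.comp (MeasurableEquiv.measurable _)).aemeasurable).trans ?_
  simp [MeasurableEquiv.piFinSuccAbove, Fin.insertNthEquiv]

lemma lintegral_pi_prod {n : ℕ} (μ : Fin n → Measure Ω) [∀ i, SigmaFinite (μ i)]
    {f : Fin n → Ω → ℝ≥0∞} (hf : ∀ i, Measurable (f i)) :
    ∫⁻ x, ∏ i, f i (x i) ∂(Measure.pi μ) = ∏ i, ∫⁻ x, f i x ∂(μ i) := by
  induction n with
  | zero => simp
  | succ n ih =>
    rw [lintegral_pi_fin_succ μ (by fun_prop)]
    simp only [Fin.prod_univ_succ, Fin.cons_zero, Fin.cons_succ]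
    simp_rw [lintegral_mul_const _ (hf 0)]
    rw [lintegral_const_mul _ (by fun_prop), ih _ fun i => hf i.succ]

lemma pi_withDensity {n : ℕ} (μ : Fin n → Measure Ω) [∀ i, SigmaFinite (μ i)]
    {f : Fin n → Ω → ℝ≥0∞} (hf : ∀ i, Measurable (f i))
    [∀ i, SigmaFinite ((μ i).withDensity (f i))] :
    Measure.pi (fun i => (μ i).withDensity (f i)) =
      (Measure.pi μ).withDensity fun x => ∏ i, f i (x i) := by
  refine Measure.pi_eq fun s hs => ?_
  have hS : MeasurableSet (Set.univ.pi s) := MeasurableSet.univ_pi hs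
  rw [withDensity_apply _ hS, ← lintegral_indicator hS]
  -- On a box the indicator factors over the coordinates, so the integral becomes a product.
  have : ∀ x : Fin n → Ω, (Set.univ.pi s).indicator (fun x => ∏ i, f i (x i)) x =
      ∏ i, (s i).indicator (f i) (x i) := by
    intro x
    by_cases hx : x ∈ Set.univ.pi s
    · rw [Set.indicator_of_mem hx]
      exact Finset.prod_congr rfl fun i _ => by
        rw [Set.indicator_of_mem (hx i (Set.mem_univ i))]
    · rw [Set.indicator_of_notMem hx]
      simp only [Set.mem_pi, Set.mem_univ, true_implies, not_forall] at hx
      obtain ⟨i, hi⟩ := hx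
      rw [Finset.prod_eq_zero (Finset.mem_univ i)]
      rw [Set.indicator_of_notMem hi]
  simp_rw [this]
  rw [lintegral_pi_prod μ fun i => (hf i).indicator (hs i)]
  exact Finset.prod_congr rfl fun i _ => by
    rw [lintegral_indicator (hs i), withDensity_apply _ (hs i)]

lemma map_withDensity_comp {α β : Type*} [MeasurableSpace α] [MeasurableSpace β] {μ : Measure α}
    {f : α → β} (hf : Measurable f) {g : β → ℝ≥0∞} (hg : Measurable g) :
    (μ.withDensity fun x => g (f x)).map f = (μ.map f).withDensity g := by
  ext s hs
  rw [Measure.map_apply hf hs, withDensity_apply _ (hf hs), withDensity_apply _ hs,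
    setLIntegral_map hs hg hf]

end Pi

/-! ### The Mehler kernel: conditional law, trace and semigroup property. -/

/-- The standard normal distribution. -/
abbrev stdNormal : Measure ℝ := gaussianReal 0 1

/-- The density of the centred bivariate normal law with unit variances and correlation `r` with
respect to the product of two standard normal laws. -/
def corrDensity (r x y : ℝ) : ℝ :=
  (√(1 - r ^ 2))⁻¹ *
    Real.exp (-(r ^ 2 * x ^ 2 + r ^ 2 * y ^ 2 - 2 * r * x * y) / (2 * (1 - r ^ 2)))

lemma corrDensity_nonneg (r x y : ℝ) : 0 ≤ corrDensity r x y := by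
  unfold corrDensity; positivity

@[fun_prop]
lemma measurable_corrDensity {α : Type*} [MeasurableSpace α] (r : ℝ) {f g : α → ℝ}
    (hf : Measurable f) (hg : Measurable g) : Measurable fun a => corrDensity r (f a) (g a) := by
  unfold corrDensity; fun_prop

lemma corrDensity_zero (x y : ℝ) : corrDensity 0 x y = 1 := by
  simp [corrDensity]

lemma corrDensity_comm (r x y : ℝ) : corrDensity r x y = corrDensity r y x := by
  unfold corrDensity; ring_nf

lemma lintegral_stdNormal {g : ℝ → ℝ≥0∞} (hg : Measurable g) :
    ∫⁻ x, g x ∂stdNormal = ∫⁻ x, gaussianPDF 0 1 x * g x := by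
  rw [stdNormal, gaussianReal_of_var_ne_zero 0 one_ne_zero,
    lintegral_withDensity_eq_lintegral_mul _ (measurable_gaussianPDF 0 1) hg]
  rfl

lemma one_sub_sq_pos {r : ℝ} (hr : |r| < 1) : 0 < 1 - r ^ 2 := by
  have := (sq_lt_one_iff_abs_lt_one r).2 hr
  linarith

lemma gaussianPDFReal_eq {m v : ℝ} (hv : 0 ≤ v) (x : ℝ) :
    gaussianPDFReal m v.toNNReal x =
      (√(2 * Real.pi))⁻¹ * (√v)⁻¹ * Real.exp (-(x - m) ^ 2 / (2 * v)) := by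
  rw [gaussianPDFReal, Real.coe_toNNReal v hv, Real.sqrt_mul (by positivity), mul_inv]

lemma gaussianPDFReal_std (x : ℝ) :
    gaussianPDFReal 0 1 x = (√(2 * Real.pi))⁻¹ * Real.exp (-x ^ 2 / 2) := by
  simp [gaussianPDFReal]

/-- Completing the square in `y`: given the first coordinate `x`, the second is normal with mean `r
* x` and variance `1 - r ^ 2`. -/
lemma stdPDF_mul_corrDensity {r : ℝ} (hr : |r| < 1) (x y : ℝ) :
    gaussianPDFReal 0 1 y * corrDensity r x y =
      gaussianPDFReal (r * x) (1 - r ^ 2).toNNReal y := by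
  have h := one_sub_sq_pos hr
  rw [gaussianPDFReal_eq h.le, gaussianPDFReal_std, corrDensity]
  have : Real.exp (-y ^ 2 / 2) *
      Real.exp (-(r ^ 2 * x ^ 2 + r ^ 2 * y ^ 2 - 2 * r * x * y) / (2 * (1 - r ^ 2))) =
      Real.exp (-(y - r * x) ^ 2 / (2 * (1 - r ^ 2))) := by
    rw [← Real.exp_add]
    congr 1
    field_simp
    ring
  rw [← this]; ring

/-- On the diagonal the exponents combine to `-x ^ 2 * (1 - r) / (2 * (1 + r))`, a multiple of a
normal density. The prefactor `(1 - r)⁻¹` is thus the trace of the kernel, in accordance with its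
eigenvalues `r ^ m`. -/
lemma stdPDF_mul_corrDensity_diag {r : ℝ} (h0 : 0 ≤ r) (hr : r < 1) (x : ℝ) :
    gaussianPDFReal 0 1 x * corrDensity r x x =
      (1 - r)⁻¹ * gaussianPDFReal 0 ((1 + r) / (1 - r)).toNNReal x := by
  have h1 : 0 < 1 - r := by linarith
  have h2 : 0 < 1 + r := by linarith
  rw [gaussianPDFReal_eq (by positivity), gaussianPDFReal_std, corrDensity]
  have h3 : Real.exp (-x ^ 2 / 2) *
      Real.exp (-(r ^ 2 * x ^ 2 + r ^ 2 * x ^ 2 - 2 * r * x * x) / (2 * (1 - r ^ 2))) =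
      Real.exp (-(x - 0) ^ 2 / (2 * ((1 + r) / (1 - r)))) := by
    rw [← Real.exp_add]
    congr 1
    rw [show 1 - r ^ 2 = (1 - r) * (1 + r) by ring]
    field_simp
    ring
  have h4 : (√(1 - r ^ 2))⁻¹ = (1 - r)⁻¹ * (√((1 + r) / (1 - r)))⁻¹ := by
    rw [show 1 - r ^ 2 = (1 - r) ^ 2 * ((1 + r) / (1 - r)) by field_simp; ring,
      Real.sqrt_mul (by positivity), Real.sqrt_sq h1.le, mul_inv]
  rw [← h3, h4]; ring

/-- Semigroup property before integration: completing the square in the middle variable `y` splits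
off a normal density in `y`, and what remains is the kernel with the product correlation. -/
lemma stdPDF_mul_corrDensity_mul_corrDensity {r s : ℝ} (hr : |r| < 1) (hs : |s| < 1)
    (x y z : ℝ) :
    gaussianPDFReal 0 1 y * (corrDensity r x y * corrDensity s y z) =
      corrDensity (r * s) x z *
        gaussianPDFReal ((r * x * (1 - s ^ 2) + s * z * (1 - r ^ 2)) / (1 - (r * s) ^ 2))
          ((1 - r ^ 2) * (1 - s ^ 2) / (1 - (r * s) ^ 2)).toNNReal y := by
  have h1 := one_sub_sq_pos hr
  have h2 := one_sub_sq_pos hs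
  have h3 : 0 < 1 - (r * s) ^ 2 := by
    rw [mul_pow]; nlinarith [sq_nonneg r, sq_nonneg s]
  rw [gaussianPDFReal_eq (by positivity), gaussianPDFReal_std, corrDensity, corrDensity,
    corrDensity, Real.sqrt_div (by positivity), Real.sqrt_mul h1.le]
  have : Real.exp (-y ^ 2 / 2) *
      Real.exp (-(r ^ 2 * x ^ 2 + r ^ 2 * y ^ 2 - 2 * r * x * y) / (2 * (1 - r ^ 2))) *
      Real.exp (-(s ^ 2 * y ^ 2 + s ^ 2 * z ^ 2 - 2 * s * y * z) / (2 * (1 - s ^ 2))) =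
      Real.exp (-((r * s) ^ 2 * x ^ 2 + (r * s) ^ 2 * z ^ 2 - 2 * (r * s) * x * z) /
        (2 * (1 - (r * s) ^ 2))) *
      Real.exp (-(y - (r * x * (1 - s ^ 2) + s * z * (1 - r ^ 2)) / (1 - (r * s) ^ 2)) ^ 2 /
        (2 * ((1 - r ^ 2) * (1 - s ^ 2) / (1 - (r * s) ^ 2)))) := by
    rw [← Real.exp_add, ← Real.exp_add, ← Real.exp_add]
    congr 1
    have h1' := h1.ne'
    have h2' := h2.ne'
    have h3' : 1 - r ^ 2 * s ^ 2 ≠ 0 := by rw [← mul_pow]; exact h3.ne'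
    simp only [mul_pow]
    field_simp
    ring
  have e1 := (Real.sqrt_pos.2 h1).ne'
  have e2 := (Real.sqrt_pos.2 h2).ne'
  have e3 : √(1 - r ^ 2 * s ^ 2) ≠ 0 := by rw [← mul_pow]; exact (Real.sqrt_pos.2 h3).ne'
  calc _ = (√(2 * Real.pi))⁻¹ * (√(1 - r ^ 2))⁻¹ * (√(1 - s ^ 2))⁻¹ * (Real.exp (-y ^ 2 / 2) *
      Real.exp (-(r ^ 2 * x ^ 2 + r ^ 2 * y ^ 2 - 2 * r * x * y) / (2 * (1 - r ^ 2))) *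
      Real.exp (-(s ^ 2 * y ^ 2 + s ^ 2 * z ^ 2 - 2 * s * y * z) / (2 * (1 - s ^ 2)))) := by ring
    _ = _ := by rw [this]; simp only [mul_pow]; field_simp

lemma lintegral_corrDensity_diag {r : ℝ} (h0 : 0 ≤ r) (hr : r < 1) :
    ∫⁻ x, ENNReal.ofReal (corrDensity r x x) ∂stdNormal = (1 - ENNReal.ofReal r)⁻¹ := by
  have h1 : 0 < 1 - r := by linarith
  have hv : ((1 + r) / (1 - r)).toNNReal ≠ 0 := by
    rw [ne_eq, Real.toNNReal_eq_zero, not_le]; positivity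
  rw [lintegral_stdNormal (by fun_prop)]
  simp_rw [gaussianPDF, ← ENNReal.ofReal_mul (gaussianPDFReal_nonneg _ _ _),
    stdPDF_mul_corrDensity_diag h0 hr, ENNReal.ofReal_mul (inv_nonneg.2 h1.le)]
  rw [lintegral_const_mul _ (by fun_prop), lintegral_gaussianPDFReal_eq_one _ hv, mul_one,
    ENNReal.ofReal_inv_of_pos h1, ENNReal.ofReal_sub _ h0, ENNReal.ofReal_one]

lemma lintegral_corrDensity_mul {r s : ℝ} (hr : |r| < 1) (hs : |s| < 1) (x z : ℝ) :
    ∫⁻ y, ENNReal.ofReal (corrDensity r x y) * ENNReal.ofReal (corrDensity s y z) ∂stdNormal =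
      ENNReal.ofReal (corrDensity (r * s) x z) := by
  have h1 := one_sub_sq_pos hr
  have h2 := one_sub_sq_pos hs
  have h3 : 0 < 1 - (r * s) ^ 2 := by
    rw [mul_pow]; nlinarith [sq_nonneg r, sq_nonneg s]
  have hv : ((1 - r ^ 2) * (1 - s ^ 2) / (1 - (r * s) ^ 2)).toNNReal ≠ 0 := by
    rw [ne_eq, Real.toNNReal_eq_zero, not_le]; positivity
  rw [lintegral_stdNormal (by fun_prop)]
  simp_rw [← ENNReal.ofReal_mul (corrDensity_nonneg _ _ _), gaussianPDF,
    ← ENNReal.ofReal_mul (gaussianPDFReal_nonneg _ _ _),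
    stdPDF_mul_corrDensity_mul_corrDensity hr hs, ENNReal.ofReal_mul (corrDensity_nonneg _ _ _)]
  rw [lintegral_const_mul _ (by fun_prop), lintegral_gaussianPDFReal_eq_one _ hv, mul_one]

/-! ### The bivariate normal law as a density over independent coordinates. -/

lemma posSemidef_corrMatrix {r : ℝ} (hr : |r| < 1) : (corrMatrix r).PosSemidef := by
  refine Matrix.PosSemidef.of_dotProduct_mulVec_nonneg ?_ fun x => ?_
  · ext i j; fin_cases i <;> fin_cases j <;> simp [corrMatrix]
  · have h := one_sub_sq_pos hr
    simp only [corrMatrix, Matrix.mulVec, dotProduct, Fin.sum_univ_two, star_trivial, Pi.star_apply]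
    simp
    nlinarith [sq_nonneg (x 0 + r * x 1), sq_nonneg (x 1)]

/-- The pair with coordinates `x` and `y`. -/
def toPair (p : ℝ × ℝ) : EuclideanSpace ℝ (Fin 2) := !₂[p.1, p.2]

@[fun_prop]
lemma measurable_toPair : Measurable toPair := by
  unfold toPair
  apply (WithLp.measurable_toLp 2 (Fin 2 → ℝ)).comp
  refine measurable_pi_iff.2 fun i => ?_
  fin_cases i
  · exact measurable_fst
  · exact measurable_snd

/-- Both sides have the same characteristic function: that of the image factors over the two
independent normals. This realisation makes the conditional law of the second coordinate explicit.
-/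
lemma pairLaw_eq_map {r : ℝ} (hr : |r| < 1) :
    pairLaw r = (stdNormal.prod stdNormal).map
      fun p => toPair (p.1, r * p.1 + √(1 - r ^ 2) * p.2) := by
  have h := one_sub_sq_pos hr
  have hm : Measurable fun p : ℝ × ℝ => toPair (p.1, r * p.1 + √(1 - r ^ 2) * p.2) := by fun_prop
  have : IsProbabilityMeasure ((stdNormal.prod stdNormal).map
      fun p => toPair (p.1, r * p.1 + √(1 - r ^ 2) * p.2)) :=
    Measure.isProbabilityMeasure_map hm.aemeasurable
  unfold pairLaw
  apply Measure.ext_of_charFun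
  ext t
  rw [charFun_multivariateGaussian (posSemidef_corrMatrix hr), charFun_apply,
    integral_map hm.aemeasurable (by fun_prop)]
  have : ∀ p : ℝ × ℝ, Complex.exp
      (((inner ℝ (toPair (p.1, r * p.1 + √(1 - r ^ 2) * p.2)) t : ℝ) : ℂ) * Complex.I) =
      Complex.exp (((inner ℝ p.1 (t 0 + r * t 1) : ℝ) : ℂ) * Complex.I) *
        Complex.exp (((inner ℝ p.2 (√(1 - r ^ 2) * t 1) : ℝ) : ℂ) * Complex.I) := by
    intro p
    rw [← Complex.exp_add]
    congr 1
    simp [toPair, PiLp.inner_apply, Fin.sum_univ_two]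
    ring
  simp_rw [this]
  rw [integral_prod_mul (fun x : ℝ => Complex.exp (((inner ℝ x (t 0 + r * t 1) : ℝ) : ℂ) *
      Complex.I)) (fun y : ℝ => Complex.exp (((inner ℝ y (√(1 - r ^ 2) * t 1) : ℝ) : ℂ) *
      Complex.I)), ← charFun_apply, ← charFun_apply, charFun_gaussianReal, charFun_gaussianReal,
      ← Complex.exp_add]
  congr 1
  have hs : ((√(1 - r ^ 2) : ℝ) : ℂ) ^ 2 = 1 - (r : ℂ) ^ 2 := by
    rw [← Complex.ofReal_pow, Real.sq_sqrt h.le]; simp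
  simp [corrMatrix, Matrix.mulVec, dotProduct, Fin.sum_univ_two, mul_pow, hs]
  ring

instance isProbabilityMeasure_pairLaw (r : ℝ) : IsProbabilityMeasure (pairLaw r) := by
  unfold pairLaw; infer_instance

lemma map_affine_stdNormal {r : ℝ} (hr : |r| < 1) (x : ℝ) :
    stdNormal.map (fun y => r * x + √(1 - r ^ 2) * y) =
      stdNormal.withDensity fun y => ENNReal.ofReal (corrDensity r x y) := by
  have h := one_sub_sq_pos hr
  have : (fun y => r * x + √(1 - r ^ 2) * y) =
      (fun y => r * x + y) ∘ fun y => √(1 - r ^ 2) * y := rfl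
  have hv : (1 - r ^ 2).toNNReal ≠ 0 := by
    rw [ne_eq, Real.toNNReal_eq_zero, not_le]; exact h
  rw [this, ← Measure.map_map (by fun_prop) (by fun_prop), gaussianReal_map_const_mul,
    gaussianReal_map_const_add]
  have e : NNReal.mk (√(1 - r ^ 2) ^ 2) (sq_nonneg _) * 1 = (1 - r ^ 2).toNNReal := by
    ext; simp [Real.sq_sqrt h.le, h.le]
  rw [e, mul_zero, zero_add, gaussianReal_of_var_ne_zero _ hv, stdNormal,
    gaussianReal_of_var_ne_zero _ one_ne_zero, ← withDensity_mul _ (by fun_prop) (by fun_prop)]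
  congr 1
  ext y
  simp only [Pi.mul_apply, gaussianPDF]
  rw [← ENNReal.ofReal_mul (gaussianPDFReal_nonneg _ _ _), stdPDF_mul_corrDensity hr]

lemma pairLaw_eq_map_withDensity {r : ℝ} (hr : |r| < 1) :
    pairLaw r = ((stdNormal.prod stdNormal).withDensity
      fun p => ENNReal.ofReal (corrDensity r p.1 p.2)).map toPair := by
  rw [pairLaw_eq_map hr]
  refine Measure.ext_of_lintegral _ fun g hg => ?_
  rw [lintegral_map hg (by fun_prop), lintegral_map hg (by fun_prop),
    lintegral_withDensity_eq_lintegral_mul _ (by fun_prop) (by fun_prop),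
    lintegral_prod _ (by fun_prop), lintegral_prod _ (by fun_prop)]
  congr 1
  ext x
  have h1 : ∫⁻ y, g (toPair (x, r * x + √(1 - r ^ 2) * y)) ∂stdNormal =
      ∫⁻ y, g (toPair (x, y)) ∂(stdNormal.map (fun y => r * x + √(1 - r ^ 2) * y)) := by
    rw [lintegral_map (by fun_prop) (by fun_prop)]
  rw [h1, map_affine_stdNormal hr,
    lintegral_withDensity_eq_lintegral_mul _ (by fun_prop) (by fun_prop)]
  rfl

lemma pairLaw_zero : pairLaw 0 = (stdNormal.prod stdNormal).map toPair := by
  rw [pairLaw_eq_map_withDensity (by simp)]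
  simp [corrDensity_zero]

lemma pairLaw_eq_withDensity {r : ℝ} (hr : |r| < 1) :
    pairLaw r = (pairLaw 0).withDensity
      fun v => ENNReal.ofReal (corrDensity r (v 0) (v 1)) := by
  rw [pairLaw_zero, ← map_withDensity_comp (by fun_prop) (by fun_prop),
    pairLaw_eq_map_withDensity hr]
  rfl

/-! ### Densities of rows and of paired databases. -/

/-- The standard normal distribution on `ℝ^d`. -/
abbrev stdRow (d : ℕ) : Measure (Fin d → ℝ) := Measure.pi fun _ => stdNormal

/-- The law of a single database with standard normal entries. -/
abbrev stdDatabase (n d : ℕ) : Measure (Fin n → Fin d → ℝ) := Measure.pi fun _ => stdRow d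

/-- The density of a pair of rows with correlation `r` with respect to independent rows. -/
def rowDensity {d : ℕ} (r : ℝ) (x y : Fin d → ℝ) : ℝ≥0∞ :=
  ∏ j, ENNReal.ofReal (corrDensity r (x j) (y j))

@[fun_prop]
lemma measurable_rowDensity {α : Type*} [MeasurableSpace α] {d : ℕ} (r : ℝ)
    {f g : α → Fin d → ℝ} (hf : Measurable f) (hg : Measurable g) :
    Measurable fun a => rowDensity r (f a) (g a) := by
  unfold rowDensity; fun_prop

lemma rowDensity_comm {d : ℕ} (r : ℝ) (x y : Fin d → ℝ) :
    rowDensity r x y = rowDensity r y x := by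
  simp [rowDensity, corrDensity_comm r]

lemma lintegral_rowDensity_diag {d : ℕ} {r : ℝ} (h0 : 0 ≤ r) (hr : r < 1) :
    ∫⁻ x, rowDensity r x x ∂(stdRow d) = (1 - ENNReal.ofReal r)⁻¹ ^ d := by
  unfold rowDensity
  rw [lintegral_pi_prod (fun _ => stdNormal)
    (f := fun _ x => ENNReal.ofReal (corrDensity r x x)) fun _ => by fun_prop]
  simp [lintegral_corrDensity_diag h0 hr]

lemma lintegral_rowDensity_mul {d : ℕ} {r s : ℝ} (hr : |r| < 1) (hs : |s| < 1)
    (x z : Fin d → ℝ) :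
    ∫⁻ y, rowDensity r x y * rowDensity s y z ∂(stdRow d) = rowDensity (r * s) x z := by
  simp_rw [rowDensity, ← Finset.prod_mul_distrib]
  rw [lintegral_pi_prod (fun _ => stdNormal)
    (f := fun j y => ENNReal.ofReal (corrDensity r (x j) y) *
      ENNReal.ofReal (corrDensity s y (z j))) fun _ => by fun_prop]
  simp [lintegral_corrDensity_mul hr hs]

@[fun_prop]
lemma measurable_assemble {n d : ℕ} (σ : Equiv.Perm (Fin n)) :
    Measurable (assemble (d := d) σ) := by
  unfold assemble; fun_prop

lemma measurePreserving_perm_stdDatabase {n d : ℕ} (σ : Equiv.Perm (Fin n)) :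
    MeasurePreserving (fun Y : Fin n → Fin d → ℝ => fun i => Y (σ.symm i))
      (stdDatabase n d) (stdDatabase n d) := by
  convert measurePreserving_piCongrLeft (fun _ : Fin n => stdRow d) σ using 1
  ext Y i : 2
  obtain ⟨i, rfl⟩ := σ.surjective i
  rw [MeasurableEquiv.piCongrLeft_apply_apply]
  simp

/-- Without correlation the two databases are independent, and permuting the i.i.d. rows of the
second does not change its law. The null law may therefore be written with any `σ`. -/
lemma pairedLaw_zero (n d : ℕ) (σ : Equiv.Perm (Fin n)) :
    pairedLaw n d σ (fun _ => 0) = (stdDatabase n d).prod (stdDatabase n d) := by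
  have hsplit : (pairLaw 0).map (fun v => (v 0, v 1)) = stdNormal.prod stdNormal := by
    rw [pairLaw_zero, Measure.map_map (by fun_prop) (by fun_prop)]
    convert Measure.map_id
    ext p <;> simp [toPair]
  have h1 : MeasurePreserving (fun v : EuclideanSpace ℝ (Fin 2) => (v 0, v 1)) (pairLaw 0)
      (stdNormal.prod stdNormal) := ⟨by fun_prop, hsplit⟩
  have h2 : MeasurePreserving (fun (u : Fin d → EuclideanSpace ℝ (Fin 2)) =>
      ((fun j => u j 0, fun j => u j 1) : (Fin d → ℝ) × (Fin d → ℝ)))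
      (Measure.pi fun _ => pairLaw 0) ((stdRow d).prod (stdRow d)) :=
    (measurePreserving_arrowProdEquivProdArrow ℝ ℝ (Fin d) (fun _ => stdNormal)
      fun _ => stdNormal).comp (measurePreserving_pi (fun _ => pairLaw 0) _ fun _ => h1)
  have h3 : MeasurePreserving (fun (z : Fin n → Fin d → EuclideanSpace ℝ (Fin 2)) =>
      ((fun i j => z i j 0, fun i j => z i j 1) : Databases n d))
      (Measure.pi fun _ => Measure.pi fun _ => pairLaw 0)
      ((stdDatabase n d).prod (stdDatabase n d)) :=
    (measurePreserving_arrowProdEquivProdArrow (Fin d → ℝ) (Fin d → ℝ) (Fin n)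
      (fun _ => stdRow d) fun _ => stdRow d).comp
      (measurePreserving_pi (fun _ => Measure.pi fun _ => pairLaw 0) _ fun _ => h2)
  exact (((MeasurePreserving.id _).prod (measurePreserving_perm_stdDatabase σ)).comp h3).map_eq

lemma nullLaw_eq (n d : ℕ) : nullLaw n d = (stdDatabase n d).prod (stdDatabase n d) :=
  pairedLaw_zero n d _

instance isProbabilityMeasure_nullLaw (n d : ℕ) : IsProbabilityMeasure (nullLaw n d) := by
  rw [nullLaw_eq]; infer_instance

instance isProbabilityMeasure_pairedLaw (n d : ℕ) (σ : Equiv.Perm (Fin n)) (r : Fin n → ℝ) :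
    IsProbabilityMeasure (pairedLaw n d σ r) :=
  Measure.isProbabilityMeasure_map (measurable_assemble σ).aemeasurable

/-- The likelihood ratio of `pairedLaw` with respect to `nullLaw`. -/
def pairedDensity {n d : ℕ} (σ : Equiv.Perm (Fin n)) (r : Fin n → ℝ) (z : Databases n d) : ℝ≥0∞ :=
  ∏ i, rowDensity (r i) (z.1 i) (z.2 (σ i))

@[fun_prop]
lemma measurable_pairedDensity {n d : ℕ} (σ : Equiv.Perm (Fin n)) (r : Fin n → ℝ) :
    Measurable (pairedDensity (d := d) σ r) := by
  unfold pairedDensity; fun_prop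

lemma pairedLaw_eq_withDensity {n d : ℕ} (σ : Equiv.Perm (Fin n)) {r : Fin n → ℝ}
    (hr : ∀ i, |r i| < 1) :
    pairedLaw n d σ r = (nullLaw n d).withDensity (pairedDensity σ r) := by
  have h1 : ∀ i, SigmaFinite ((pairLaw 0).withDensity
      fun v => ENNReal.ofReal (corrDensity (r i) (v 0) (v 1))) := fun i => by
    rw [← pairLaw_eq_withDensity (hr i)]; infer_instance
  have h2 : ∀ i, Measure.pi (fun _ : Fin d => pairLaw (r i)) =
      (Measure.pi fun _ => pairLaw 0).withDensity
        fun u => rowDensity (r i) (fun j => u j 0) fun j => u j 1 := fun i => by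
    simp_rw [pairLaw_eq_withDensity (hr i)]
    have := h1 i
    rw [pi_withDensity _ fun _ => by fun_prop]
    rfl
  have h3 : ∀ i, SigmaFinite ((Measure.pi fun _ : Fin d => pairLaw 0).withDensity
      fun u => rowDensity (r i) (fun j => u j 0) fun j => u j 1) := fun i => by
    rw [← h2 i]; infer_instance
  -- Writing the null law with the same `σ` makes both laws images under one `assemble σ`, so only
  -- the densities before assembling need comparison.
  rw [nullLaw_eq, ← pairedLaw_zero n d σ, pairedLaw, pairedLaw,
    ← map_withDensity_comp (by fun_prop) (by fun_prop)]
  simp_rw [h2]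
  rw [pi_withDensity _ fun i => by fun_prop]
  simp [pairedDensity, assemble]

/-! ### Products of kernels along the edges of a permutation. -/

lemma prod_update_kernel {Ω : Type*} {F : ℝ → Ω → Ω → ℝ≥0∞} {n : ℕ}
    (e : Equiv.Perm (Fin n)) (c : Fin n → ℝ) (q : Fin n) (t : ℝ)
    (x : Fin n → Ω) :
    ∏ i, F (Function.update c q t i) (x i) (x (e i)) =
      F t (x q) (x (e q)) * ∏ i ∈ Finset.univ.erase q, F (c i) (x i) (x (e i)) := by
  rw [← Finset.mul_prod_erase _ _ (Finset.mem_univ q), Function.update_self]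
  congr 1
  exact Finset.prod_congr rfl fun i hi => by
    rw [Function.update_of_ne (Finset.mem_erase.1 hi).1]

section Kernel

variable {Ω : Type*} [MeasurableSpace Ω] (ν : Measure Ω) [SigmaFinite ν] {F : ℝ → Ω → Ω → ℝ≥0∞}

/-- The integral of the product of the kernels `F (c i)` along the edges `i → π i`. -/
def cycleIntegral (F : ℝ → Ω → Ω → ℝ≥0∞) {n : ℕ} (π : Equiv.Perm (Fin n)) (c : Fin n → ℝ) :
    ℝ≥0∞ :=
  ∫⁻ x, ∏ i, F (c i) (x i) (x (π i)) ∂(Measure.pi fun _ => ν)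

/-- Here `0` is a fixed point of the permutation: its loop splits off as a trace. -/
lemma cycleIntegral_of_fixed (hF : ∀ r, Measurable (Function.uncurry (F r))) {n : ℕ}
    (e : Equiv.Perm (Fin n)) (c : Fin (n + 1) → ℝ) :
    cycleIntegral ν F (Equiv.Perm.decomposeFin.symm (0, e)) c =
      (∫⁻ x, F (c 0) x x ∂ν) * cycleIntegral ν F e fun i => c i.succ := by
  have hF' : ∀ r {α : Type _} [MeasurableSpace α] {f g : α → Ω}, Measurable f → Measurable g →
      Measurable fun a => F r (f a) (g a) := fun r _ _ _ _ hf hg => (hF r).comp (hf.prodMk hg)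
  unfold cycleIntegral
  rw [lintegral_pi_fin_succ]
  · simp only [Fin.prod_univ_succ, Equiv.Perm.decomposeFin_symm_apply_zero,
      Equiv.Perm.decomposeFin_symm_apply_succ, Equiv.swap_self, Equiv.refl_apply, Fin.cons_zero,
      Fin.cons_succ]
    refine (lintegral_congr fun y =>
      lintegral_mul_const _ (hF' (c 0) measurable_id measurable_id)).trans ?_
    rw [lintegral_const_mul]
    · rfl
    exact Finset.measurable_prod _ fun i _ => hF' _ (by fun_prop) (by fun_prop)
  · exact Finset.measurable_prod _ fun i _ => hF' _ (by fun_prop) (by fun_prop)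

/-- Here the permutation sends `q.succ` to `0` and `0` to `(e q).succ`. Integrating out the vertex
`0` composes these two edges into one edge `q → e q`, and `e` is the permutation that remains. -/
lemma cycleIntegral_of_not_fixed (hF : ∀ r, Measurable (Function.uncurry (F r))) {n : ℕ}
    (e : Equiv.Perm (Fin n)) (c : Fin (n + 1) → ℝ) (q : Fin n) :
    cycleIntegral ν F (Equiv.Perm.decomposeFin.symm ((e q).succ, e)) c =
      ∫⁻ x, (∫⁻ y, F (c q.succ) (x q) y * F (c 0) y (x (e q)) ∂ν) *
        ∏ i ∈ Finset.univ.erase q, F (c i.succ) (x i) (x (e i)) ∂(Measure.pi fun _ => ν) := by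
  have hF' : ∀ r {α : Type _} [MeasurableSpace α] {f g : α → Ω}, Measurable f → Measurable g →
      Measurable fun a => F r (f a) (g a) := fun r _ _ _ _ hf hg => (hF r).comp (hf.prodMk hg)
  unfold cycleIntegral
  rw [lintegral_pi_fin_succ]
  · refine lintegral_congr fun x => ?_
    refine Eq.trans ?_ (lintegral_mul_const _ ((hF' _ measurable_const measurable_id).mul
      (hF' _ measurable_id measurable_const)))
    refine lintegral_congr fun y => ?_
    rw [Fin.prod_univ_succ, ← Finset.mul_prod_erase _ _ (Finset.mem_univ q)]
    simp only [Equiv.Perm.decomposeFin_symm_apply_zero,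
      Equiv.Perm.decomposeFin_symm_apply_succ, Equiv.swap_apply_right, Fin.cons_zero,
      Fin.cons_succ]
    rw [mul_left_comm, ← mul_assoc]
    congr 1
    refine Finset.prod_congr rfl fun i hi => ?_
    rw [Equiv.swap_apply_of_ne_of_ne (Fin.succ_ne_zero _), Fin.cons_succ]
    simpa using (Finset.mem_erase.1 hi).1
  · exact Finset.measurable_prod _ fun i _ => hF' _ (by fun_prop) (by fun_prop)

/-- Comparison of cycle integrals: it suffices to compare the traces of a kernel that is
submultiplicative and of one that is supermultiplicative. -/
lemma cycleIntegral_le {Ω' : Type*} [MeasurableSpace Ω'] (ν' : Measure Ω') [SigmaFinite ν']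
    {F' : ℝ → Ω' → Ω' → ℝ≥0∞} (hF : ∀ r, Measurable (Function.uncurry (F r)))
    (hF' : ∀ r, Measurable (Function.uncurry (F' r)))
    (hmul : ∀ r ∈ Set.Ico (0 : ℝ) 1, ∀ s ∈ Set.Ico (0 : ℝ) 1, ∀ x z,
      ∫⁻ y, F r x y * F s y z ∂ν ≤ F (r * s) x z)
    (hmul' : ∀ r ∈ Set.Ico (0 : ℝ) 1, ∀ s ∈ Set.Ico (0 : ℝ) 1, ∀ x z,
      F' (r * s) x z ≤ ∫⁻ y, F' r x y * F' s y z ∂ν')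
    (htr : ∀ r ∈ Set.Ico (0 : ℝ) 1, ∫⁻ x, F r x x ∂ν ≤ ∫⁻ x, F' r x x ∂ν')
    {n : ℕ} (π : Equiv.Perm (Fin n)) {c : Fin n → ℝ} (hc : ∀ i, c i ∈ Set.Ico (0 : ℝ) 1) :
    cycleIntegral ν F π c ≤ cycleIntegral ν' F' π c := by
  induction n with
  | zero => simp [cycleIntegral]
  | succ n ih =>
    obtain ⟨⟨p, e⟩, rfl⟩ := Equiv.Perm.decomposeFin.symm.surjective π
    rcases Fin.eq_zero_or_eq_succ p with rfl | ⟨p, rfl⟩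
    · rw [cycleIntegral_of_fixed ν hF, cycleIntegral_of_fixed ν' hF']
      exact mul_le_mul' (htr _ (hc 0)) (ih e fun i => hc i.succ)
    · obtain ⟨q, rfl⟩ := e.surjective p
      -- After contraction the new edge carries the product of the two correlations, which stays in
      -- `[0, 1)`; the induction hypothesis applies to these updated values.
      have hc' : ∀ i, Function.update (fun i : Fin n => c i.succ) q (c q.succ * c 0) i ∈
          Set.Ico (0 : ℝ) 1 := fun i => by
        rcases eq_or_ne i q with rfl | hi
        · rw [Function.update_self]
          exact ⟨mul_nonneg (hc _).1 (hc _).1, mul_lt_one_of_nonneg_of_lt_one_left (hc _).1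
            (hc _).2 (hc _).2.le⟩
        · rw [Function.update_of_ne hi]
          exact hc _
      rw [cycleIntegral_of_not_fixed ν hF, cycleIntegral_of_not_fixed ν' hF']
      refine le_trans ?_ ((ih e hc').trans ?_)
      · refine lintegral_mono fun x => ?_
        rw [prod_update_kernel]
        gcongr
        exact hmul _ (hc _) _ (hc _) _ _
      · refine lintegral_mono fun x => ?_
        rw [prod_update_kernel]
        gcongr
        exact hmul' _ (hc _) _ (hc _) _ _

end Kernel

/-! ### Comparison with a diagonal kernel. -/

/-- The diagonal kernel on `ℕ` with eigenvalues `(d * c) ^ a`. -/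
def diagKernel (d : ℕ) (c : ℝ) (a b : ℕ) : ℝ≥0∞ :=
  if a = b then ENNReal.ofReal (d * c) ^ a else 0

lemma lintegral_diagKernel_diag (d : ℕ) (c : ℝ) :
    ∫⁻ a, diagKernel d c a a ∂Measure.count = (1 - ENNReal.ofReal (d * c))⁻¹ := by
  simp [lintegral_count, diagKernel, ENNReal.tsum_geometric]

lemma diagKernel_mul_le {d : ℕ} (hd : 1 ≤ d) {r s : ℝ} (hr : 0 ≤ r) (hs : 0 ≤ s) (a b : ℕ) :
    diagKernel d (r * s) a b ≤ ∫⁻ e, diagKernel d r a e * diagKernel d s e b ∂Measure.count := by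
  rw [lintegral_count]
  -- Only the term `e = a` is kept; the claim is then `d * (r * s) ≤ (d * r) * (d * s)`, where `1 ≤
  -- d` enters.
  refine le_trans ?_ (ENNReal.le_tsum a)
  unfold diagKernel
  by_cases h : a = b
  · simp only [h, if_true]
    rw [← mul_pow, ← ENNReal.ofReal_mul (by positivity)]
    refine pow_le_pow_left₀ zero_le (ENNReal.ofReal_le_ofReal ?_) _
    rw [mul_mul_mul_comm, mul_assoc]
    exact le_mul_of_one_le_left (by positivity) (by exact_mod_cast hd)
  · simp [h]

/-- Bernoulli's inequality `1 - d * r ≤ (1 - r) ^ d`. When `1 ≤ d * r` the right-hand side is `∞`,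
so no smallness of `d * r` is needed. -/
lemma inv_one_sub_pow_le {d : ℕ} {r : ℝ} (h0 : 0 ≤ r) (hr : r < 1) :
    (1 - ENNReal.ofReal r)⁻¹ ^ d ≤ (1 - ENNReal.ofReal (d * r))⁻¹ := by
  rw [← ENNReal.inv_pow, ENNReal.inv_le_inv, ← ENNReal.ofReal_one, ← ENNReal.ofReal_sub _ h0,
    ← ENNReal.ofReal_sub _ (by positivity), ← ENNReal.ofReal_pow (by linarith)]
  refine ENNReal.ofReal_le_ofReal ?_
  have := one_add_mul_le_pow (a := -r) (by linarith) d
  calc 1 - d * r = 1 + d * (-r) := by ring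
    _ ≤ _ := this
    _ = _ := by ring

lemma cycleIntegral_rowDensity_le {n d : ℕ} (hd : 1 ≤ d) (π : Equiv.Perm (Fin n)) {c : Fin n → ℝ}
    (hc : ∀ i, c i ∈ Set.Ico (0 : ℝ) 1) :
    cycleIntegral (stdRow d) rowDensity π c ≤ cycleIntegral Measure.count (diagKernel d) π c := by
  have habs : ∀ r ∈ Set.Ico (0 : ℝ) 1, |r| < 1 := fun r hr => by
    rw [abs_of_nonneg hr.1]; exact hr.2
  refine cycleIntegral_le _ _ (fun r => ?_) (fun r => measurable_of_countable _) ?_ ?_ ?_ π hc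
  · unfold Function.uncurry; fun_prop
  · exact fun r hr s hs x z => (lintegral_rowDensity_mul (habs r hr) (habs s hs) x z).le
  · exact fun r hr s hs x z => diagKernel_mul_le hd hr.1 hs.1 x z
  · intro r hr
    rw [lintegral_rowDensity_diag hr.1 hr.2, lintegral_diagKernel_diag]
    exact inv_one_sub_pow_le hr.1 hr.2

lemma pi_count (n : ℕ) :
    (Measure.pi fun _ : Fin n => (Measure.count : Measure ℕ)) = Measure.count := by
  refine Measure.ext_of_singleton fun a => ?_
  rw [← Set.univ_pi_singleton, Measure.pi_pi, Set.univ_pi_singleton]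
  simp

/-- For fixed `X`, the row `Y j` is tied to `X (σ⁻¹ j)` by the first density and to `X (σ'⁻¹ j)` by
the second. Integrating it out joins these two rows by one kernel; putting `j = σ i` gives the edge
`i → (σ'⁻¹ * σ) i`. -/
lemma lintegral_pairedDensity_mul {n d : ℕ} (σ σ' : Equiv.Perm (Fin n)) {r r' : Fin n → ℝ}
    (hr : ∀ i, |r i| < 1) (hr' : ∀ i, |r' i| < 1) :
    ∫⁻ z, pairedDensity (d := d) σ r z * pairedDensity σ' r' z ∂(nullLaw n d) =
      cycleIntegral (stdRow d) rowDensity (σ'⁻¹ * σ) fun i => r i * r' ((σ'⁻¹ * σ) i) := by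
  rw [nullLaw_eq, lintegral_prod _ (by fun_prop), cycleIntegral]
  refine lintegral_congr fun X => ?_
  have h : ∀ Y : Fin n → Fin d → ℝ, pairedDensity σ r (X, Y) * pairedDensity σ' r' (X, Y) =
      ∏ j, rowDensity (r (σ⁻¹ j)) (X (σ⁻¹ j)) (Y j) *
        rowDensity (r' (σ'⁻¹ j)) (Y j) (X (σ'⁻¹ j)) := fun Y => by
    rw [Finset.prod_mul_distrib]
    congr 1
    · rw [← Equiv.prod_comp σ]; simp [pairedDensity]
    · rw [← Equiv.prod_comp σ']; simp [pairedDensity, rowDensity_comm]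
  simp_rw [h]
  rw [lintegral_pi_prod (fun _ => stdRow d) (f := fun j y =>
    rowDensity (r (σ⁻¹ j)) (X (σ⁻¹ j)) y * rowDensity (r' (σ'⁻¹ j)) y (X (σ'⁻¹ j)))
    fun j => by fun_prop]
  simp_rw [lintegral_rowDensity_mul (hr _) (hr' _)]
  rw [← Equiv.prod_comp σ]
  simp

/-! ### From kernels to sums over integer vectors. -/

/-- The correlations of the rows when those in `K` have correlation `ρ`. -/
abbrev rowCorr {n : ℕ} (ρ : ℝ) (K : Finset (Fin n)) (i : Fin n) : ℝ := if i ∈ K then ρ else 0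

lemma abs_rowCorr_lt {n : ℕ} {ρ : ℝ} (hρ : |ρ| < 1) (K : Finset (Fin n)) (i : Fin n) :
    |rowCorr ρ K i| < 1 := by
  unfold rowCorr; split_ifs <;> simp [hρ]

/-- The set of the indices of the non-zero values of `a`. -/
abbrev supp {n : ℕ} (a : Fin n → ℕ) : Finset (Fin n) := Finset.univ.filter fun i => a i ≠ 0

/-- The diagonal kernel forces `a` to be constant along edges, and an edge of correlation `0` forces
the value `0` there. Since `a` is invariant under `π`, the condition `π i ∈ K'` on the support
becomes `supp a ⊆ K'`. -/
lemma cycleIntegral_diagKernel_le {n d : ℕ} {ρ : ℝ} (π : Equiv.Perm (Fin n))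
    (K K' : Finset (Fin n)) :
    cycleIntegral Measure.count (diagKernel d) π (fun i => rowCorr ρ K i * rowCorr ρ K' (π i)) ≤
      ∑' a : Fin n → ℕ, ENNReal.ofReal (d * ρ ^ 2) ^ (∑ i, a i) *
        (if a ∘ π = a then 1 else 0) * (if supp a ⊆ K then 1 else 0) *
        (if supp a ⊆ K' then 1 else 0) := by
  rw [cycleIntegral, pi_count, lintegral_count]
  refine ENNReal.tsum_le_tsum fun a => ?_
  by_cases h1 : a ∘ π = a
  swap
  · obtain ⟨i, hi⟩ := Function.ne_iff.1 h1
    rw [Finset.prod_eq_zero (Finset.mem_univ i)]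
    · exact zero_le
    · rw [diagKernel, if_neg fun h => hi h.symm]
  have h1' : ∀ i, a (π i) = a i := fun i => congrFun h1 i
  by_cases h2 : supp a ⊆ K
  swap
  · obtain ⟨i, hi, hiK⟩ := Finset.not_subset.1 h2
    rw [Finset.prod_eq_zero (Finset.mem_univ i)]
    · exact zero_le
    · have : a i ≠ 0 := by simpa using hi
      simp [diagKernel, rowCorr, hiK, this]
  by_cases h3 : supp a ⊆ K'
  swap
  · obtain ⟨i, hi, hiK⟩ := Finset.not_subset.1 h3
    obtain ⟨i, rfl⟩ := π.surjective i
    rw [Finset.prod_eq_zero (Finset.mem_univ i)]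
    · exact zero_le
    · have : a i ≠ 0 := by simpa [h1'] using hi
      simp [diagKernel, rowCorr, hiK, this]
  rw [if_pos h1, if_pos h2, if_pos h3, mul_one, mul_one, mul_one, ← Finset.prod_pow_eq_pow_sum]
  refine Finset.prod_le_prod' fun i _ => ?_
  rw [diagKernel, if_pos (h1' i).symm]
  by_cases hi : a i = 0
  · simp [hi]
  · have hK : i ∈ K := h2 (by simpa using hi)
    have hK' : π i ∈ K' := h3 (by simpa [h1'] using hi)
    simp [rowCorr, hK, hK', sq]

/-! ### Integer vectors up to permutation, and partitions with at most `k` parts. -/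

/-- The antitone function on `Fin n` with decrements `b i` at `i < k`, vanishing from `k` on. -/
def tailSum {n k : ℕ} (b : Fin k → ℕ) (j : Fin n) : ℕ :=
  ∑ i : Fin k, if (j : ℕ) ≤ i then b i else 0

/-- The decrement `b i` is counted at the `i + 1` positions `0, …, i`; this is conjugation of
partitions, and the hypothesis `k ≤ n` ensures that all these positions exist. -/
lemma sum_tailSum {n k : ℕ} (hk : k ≤ n) (b : Fin k → ℕ) :
    ∑ j : Fin n, tailSum b j = ∑ i : Fin k, ((i : ℕ) + 1) * b i := by
  unfold tailSum
  rw [Finset.sum_comm]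
  refine Finset.sum_congr rfl fun i _ => ?_
  rw [← Finset.sum_filter, Finset.sum_const, smul_eq_mul]
  congr 1
  have : (Finset.univ.filter fun j : Fin n => (j : ℕ) ≤ i) =
      Finset.Iic ⟨i, i.2.trans_le hk⟩ := by
    ext j; simp [Fin.le_def]
  rw [this, Fin.card_Iic]

lemma sum_Ico_sub_of_antitone {A : ℕ → ℕ} (hA : Antitone A) {j m : ℕ} (hjm : j ≤ m) :
    ∑ i ∈ Finset.Ico j m, (A i - A (i + 1)) = A j - A m := by
  induction m, hjm using Nat.le_induction with
  | base => simp
  | succ m hm ih =>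
    rw [Finset.sum_Ico_succ_top hm, ih]
    have := hA hm
    have := hA (Nat.le_succ m)
    simp only [Nat.succ_eq_add_one] at this
    omega

lemma card_supp_comp {n : ℕ} (a : Fin n → ℕ) (τ : Equiv.Perm (Fin n)) :
    (supp (a ∘ τ)).card = (supp a).card :=
  Finset.card_equiv τ fun i => by simp

/-- Sort `a` in decreasing order and take consecutive differences; at most `k` values are non-zero,
so the sorted vector vanishes from position `k` on and the differences telescope. -/
lemma exists_eq_tailSum_comp {n k : ℕ} (a : Fin n → ℕ) (ha : (supp a).card ≤ k) :
    ∃ (b : Fin k → ℕ) (τ : Equiv.Perm (Fin n)), tailSum b ∘ τ = a := by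
  let τ : Equiv.Perm (Fin n) := Fin.revPerm.trans (Tuple.sort a)
  have hanti : Antitone (a ∘ τ) := fun i j hij =>
    Tuple.monotone_sort a (Fin.rev_le_rev.2 hij)
  -- Extension by `0` beyond `n` keeps the sequence antitone and makes `A k = 0` meaningful even for
  -- `k ≥ n`.
  let A : ℕ → ℕ := fun m => if h : m < n then a (τ ⟨m, h⟩) else 0
  have hA : Antitone A := fun i j hij => by
    by_cases hj : j < n
    · have hi : i < n := hij.trans_lt hj
      simp only [A, hi, hj, dif_pos]
      exact hanti (Fin.mk_le_mk.2 hij)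
    · simp [A, hj]
  have hz : ∀ m, k ≤ m → A m = 0 := fun m hm => by
    by_contra h
    have hmn : m < n := by
      by_contra h'
      exact h (by simp [A, h'])
    -- A non-zero value at position `m ≥ k` would give `m + 1 > k` non-zero values.
    have hsub : Finset.Iic (⟨m, hmn⟩ : Fin n) ⊆ supp (a ∘ τ) := fun i hi => by
      have h1 : A m ≤ A i := hA (Fin.le_def.1 (Finset.mem_Iic.1 hi))
      have h2 : A i = a (τ i) := by simp [A]
      simp only [Finset.mem_filter, Finset.mem_univ, true_and, Function.comp]
      omega
    have := Finset.card_le_card hsub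
    rw [card_supp_comp, Fin.card_Iic] at this
    simp only at this
    omega
  refine ⟨fun i => A i - A (i + 1), τ⁻¹, ?_⟩
  suffices h : ∀ j : Fin n, tailSum (fun i : Fin k => A i - A (i + 1)) j = A j by
    ext j
    rw [Function.comp, h]
    simp [A]
  intro j
  unfold tailSum
  rw [Fin.sum_univ_eq_sum_range (fun i => if (j : ℕ) ≤ i then A i - A (i + 1) else 0),
    ← Finset.sum_filter]
  rcases le_total (j : ℕ) k with hj | hj
  · have : (Finset.range k).filter (fun i => (j : ℕ) ≤ i) = Finset.Ico (j : ℕ) k := by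
      ext i; simp [and_comm]
    rw [this, sum_Ico_sub_of_antitone hA hj, hz k le_rfl, Nat.sub_zero]
  · rw [hz j hj]
    refine Finset.sum_eq_zero fun i hi => ?_
    simp only [Finset.mem_filter, Finset.mem_range] at hi
    omega

/-- The number of permutations leaving `a` invariant. -/
def stabCard {n : ℕ} (a : Fin n → ℕ) : ℕ :=
  (Finset.univ.filter fun π : Equiv.Perm (Fin n) => a ∘ π = a).card

/-- Left multiplication by `τ` embeds the stabiliser of `a` into the set of permutations carrying
`tailSum b` to `a`. -/
lemma stabCard_le {n k : ℕ} {a : Fin n → ℕ} {b : Fin k → ℕ} {τ : Equiv.Perm (Fin n)}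
    (h : tailSum b ∘ τ = a) :
    stabCard a ≤ (Finset.univ.filter fun τ : Equiv.Perm (Fin n) => tailSum b ∘ τ = a).card := by
  refine Finset.card_le_card_of_injOn (fun π => τ * π) (fun π hπ => ?_)
    (mul_right_injective τ).injOn
  simp only [Finset.coe_filter, Finset.mem_univ, true_and, Set.mem_ofPred_eq] at hπ ⊢
  rw [Equiv.Perm.coe_mul, ← Function.comp_assoc, h, hπ]

lemma tsum_weighted_pow (k : ℕ) (x : ℝ≥0∞) :
    ∑' b : Fin k → ℕ, x ^ (∑ i : Fin k, ((i : ℕ) + 1) * b i) =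
      ∏ i : Fin k, (1 - x ^ ((i : ℕ) + 1))⁻¹ := by
  have := lintegral_pi_prod (fun _ : Fin k => (Measure.count : Measure ℕ))
    (f := fun i b => (x ^ ((i : ℕ) + 1)) ^ b) fun i => measurable_of_countable _
  rw [pi_count, lintegral_count] at this
  simp_rw [lintegral_count, ENNReal.tsum_geometric, ← pow_mul, Finset.prod_pow_eq_pow_sum] at this
  exact this

/-- The weights of the functions with at most `k` non-zero values, up to permutation. -/
lemma tsum_stabCard_le {n k : ℕ} (hk : k ≤ n) (x : ℝ≥0∞) :
    ∑' a : Fin n → ℕ, (if (supp a).card ≤ k then x ^ (∑ i, a i) * stabCard a else 0) ≤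
      n.factorial * ∏ i : Fin k, (1 - x ^ ((i : ℕ) + 1))⁻¹ := by
  -- The stabiliser is bounded by the number of `τ` for a single suitable `b`. After exchanging the
  -- sums, each pair `(b, τ)` determines exactly one `a`, which leaves `n!` copies of the sum over
  -- `b`.
  calc _ ≤ ∑' a : Fin n → ℕ, ∑' b : Fin k → ℕ, ∑ τ : Equiv.Perm (Fin n),
        if a = tailSum b ∘ τ then x ^ (∑ i : Fin k, ((i : ℕ) + 1) * b i) else 0 := by
        refine ENNReal.tsum_le_tsum fun a => ?_
        split_ifs with ha
        · obtain ⟨b, τ, h⟩ := exists_eq_tailSum_comp a ha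
          refine le_trans ?_ (ENNReal.le_tsum b)
          have hs : ∑ i, a i = ∑ i : Fin k, ((i : ℕ) + 1) * b i := by
            rw [← sum_tailSum hk b, ← h]
            exact Equiv.sum_comp τ _
          rw [← Finset.sum_filter, Finset.sum_const, nsmul_eq_mul, mul_comm, hs]
          refine mul_le_mul' (Nat.cast_le.2 ?_) le_rfl
          refine (stabCard_le h).trans (le_of_eq ?_)
          congr 1
          ext π
          simp [eq_comm]
        · exact zero_le
    _ = ∑' b : Fin k → ℕ, ∑ τ : Equiv.Perm (Fin n), x ^ (∑ i : Fin k, ((i : ℕ) + 1) * b i) := by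
        rw [ENNReal.tsum_comm]
        refine tsum_congr fun b => ?_
        rw [Summable.tsum_finsetSum fun _ _ => ENNReal.summable]
        exact Finset.sum_congr rfl fun τ _ => tsum_ite_eq _ _
    _ = _ := by
        simp only [Finset.sum_const, Finset.card_univ, Fintype.card_perm, Fintype.card_fin,
          nsmul_eq_mul]
        rw [ENNReal.tsum_mul_left, tsum_weighted_pow]

/-! ### Counting the `k`-element sets that contain a support. -/

/-- The number of `k`-element sets containing the support of `a`. -/
def coverCard {n : ℕ} (k : ℕ) (a : Fin n → ℕ) : ℕ :=
  (((Finset.univ : Finset (Fin n)).powersetCard k).filter fun K => supp a ⊆ K).card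

lemma coverCard_zero {n : ℕ} (k : ℕ) : coverCard k (0 : Fin n → ℕ) = n.choose k := by
  simp [coverCard, supp]

lemma coverCard_eq_zero {n k : ℕ} {a : Fin n → ℕ} (ha : k < (supp a).card) : coverCard k a = 0 := by
  rw [coverCard, Finset.card_eq_zero, Finset.filter_eq_empty_iff]
  intro K hK h
  have := Finset.card_le_card h
  rw [(Finset.mem_powersetCard.1 hK).2] at this
  omega

/-- A covering set must contain some fixed `i` with `a i ≠ 0`; erasing `i` leaves a set of size `k -
1` among `n - 1` points, and `n * (n - 1).choose (k - 1) = k * n.choose k` for `k, n ≥ 1`. This is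
the source of the factor `k / n`. -/
lemma mul_coverCard_le {n k : ℕ} {a : Fin n → ℕ} (ha : a ≠ 0) :
    n * coverCard k a ≤ k * n.choose k := by
  obtain ⟨i, hi⟩ := Function.ne_iff.1 ha
  rcases k with _ | k
  · rw [coverCard_eq_zero (Finset.card_pos.2 ⟨i, by simpa using hi⟩)]
    simp
  obtain ⟨n, rfl⟩ : ∃ m, n = m + 1 := ⟨n - 1, by have := i.pos; omega⟩
  rw [mul_comm (k + 1), ← Nat.add_one_mul_choose_eq]
  refine Nat.mul_le_mul_left _ ?_
  have h : coverCard (k + 1) a ≤ ((Finset.univ.erase i).powersetCard k).card := by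
    refine Finset.card_le_card_of_injOn (fun K => K.erase i) (fun K hK => ?_) ?_
    · simp only [Finset.coe_filter, Finset.mem_powersetCard, Set.mem_ofPred_eq] at hK
      have hiK : i ∈ K := hK.2 (by simpa using hi)
      simp only [Finset.mem_coe, Finset.mem_powersetCard]
      exact ⟨Finset.erase_subset_erase i (Finset.subset_univ K), by
        rw [Finset.card_erase_of_mem hiK, hK.1.2]; rfl⟩
    · intro K hK K' hK' h
      simp only [Finset.coe_filter, Finset.mem_powersetCard, Set.mem_ofPred_eq] at hK hK'
      have hiK : i ∈ K := hK.2 (by simpa using hi)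
      have hiK' : i ∈ K' := hK'.2 (by simpa using hi)
      rw [← Finset.insert_erase hiK, ← Finset.insert_erase hiK']
      exact congrArg (insert i) h
  simpa using h

lemma coverCard_le {n k : ℕ} (hn : 1 ≤ n) {a : Fin n → ℕ} (ha : a ≠ 0) :
    (coverCard k a : ℝ≥0∞) ≤ (k / n : ℝ≥0∞) * n.choose k := by
  have h0 : (n : ℝ≥0∞) ≠ 0 := by simp; omega
  rw [← ENNReal.mul_div_right_comm, ENNReal.le_div_iff_mul_le (Or.inl h0) (Or.inl (by simp)),
    mul_comm]
  exact_mod_cast mul_coverCard_le ha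

/-! ### The second moment of the likelihood ratio. -/

/-- The likelihood ratio of the alternative with respect to the null hypothesis, as the average of
the conditional likelihood ratios. -/
def altDensity (n k d : ℕ) (ρ : ℝ) (z : Databases n d) : ℝ≥0∞ :=
  ((n.factorial * n.choose k : ℕ) : ℝ≥0∞)⁻¹ * ∑ σ : Equiv.Perm (Fin n),
    ∑ K ∈ (Finset.univ : Finset (Fin n)).powersetCard k, pairedDensity σ (rowCorr ρ K) z

@[fun_prop]
lemma measurable_altDensity (n k d : ℕ) (ρ : ℝ) : Measurable (altDensity n k d ρ) := by
  unfold altDensity; fun_prop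

lemma altLaw_eq_withDensity {n k d : ℕ} {ρ : ℝ} (hρ : |ρ| < 1) :
    altLaw n k d ρ = (nullLaw n d).withDensity (altDensity n k d ρ) := by
  ext s hs
  rw [withDensity_apply _ hs]
  unfold altDensity
  rw [lintegral_const_mul _ (by fun_prop), lintegral_finsetSum _ (fun _ _ => by fun_prop), altLaw]
  simp only [Measure.smul_apply, Measure.finsetSum_apply, smul_eq_mul]
  congr 1
  refine Finset.sum_congr rfl fun σ _ => ?_
  rw [lintegral_finsetSum _ (fun _ _ => by fun_prop)]
  refine Finset.sum_congr rfl fun K _ => ?_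
  rw [condAltLaw, pairedLaw_eq_withDensity σ (abs_rowCorr_lt hρ K), withDensity_apply _ hs]

/-- For fixed `σ'`, the product `σ'⁻¹ * σ` runs over all permutations once. -/
lemma card_filter_perm_pairs {n : ℕ} (a : Fin n → ℕ) :
    ∑ σ : Equiv.Perm (Fin n), ∑ σ' : Equiv.Perm (Fin n),
      (if a ∘ ⇑(σ'⁻¹ * σ) = a then 1 else 0 : ℝ≥0∞) = n.factorial * stabCard a := by
  rw [Finset.sum_comm]
  have : ∀ σ' : Equiv.Perm (Fin n), ∑ σ : Equiv.Perm (Fin n),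
      (if a ∘ ⇑(σ'⁻¹ * σ) = a then 1 else 0 : ℝ≥0∞) = stabCard a := fun σ' => by
    have h := Equiv.sum_comp (Equiv.mulLeft σ'⁻¹)
      fun π => (if a ∘ ⇑π = a then 1 else 0 : ℝ≥0∞)
    rw [Finset.sum_boole (p := fun π : Equiv.Perm (Fin n) => a ∘ ⇑π = a)] at h
    exact h
  simp only [this, Finset.sum_const, Finset.card_univ, Fintype.card_perm, Fintype.card_fin,
    nsmul_eq_mul]

lemma lintegral_sum_sq_le {n k d : ℕ} (hd : 1 ≤ d) {ρ : ℝ} (hρ : |ρ| < 1) :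
    ∫⁻ z, (∑ σ : Equiv.Perm (Fin n), ∑ K ∈ (Finset.univ : Finset (Fin n)).powersetCard k,
      pairedDensity (d := d) σ (rowCorr ρ K) z) ^ 2 ∂(nullLaw n d) ≤
    ∑' a : Fin n → ℕ, ENNReal.ofReal (d * ρ ^ 2) ^ (∑ i, a i) *
      (n.factorial * stabCard a) * (coverCard k a) ^ 2 := by
  -- Each product is `0` or `ρ ^ 2`, so the sign of `ρ` disappears and the comparison for `[0, 1)`
  -- applies.
  have hc : ∀ (K K' : Finset (Fin n)) (π : Equiv.Perm (Fin n)) i,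
      rowCorr ρ K i * rowCorr ρ K' (π i) ∈ Set.Ico (0 : ℝ) 1 := fun K K' π i => by
    have h1 : ρ * ρ < 1 := by
      have := (sq_lt_one_iff_abs_lt_one ρ).2 hρ
      nlinarith
    unfold rowCorr
    split_ifs <;> simp [h1, mul_self_nonneg]
  set P := (Finset.univ : Finset (Fin n)).powersetCard k with hP
  set x := ENNReal.ofReal (d * ρ ^ 2) with hx
  calc _ = ∑ σ : Equiv.Perm (Fin n), ∑ σ' : Equiv.Perm (Fin n), ∑ K ∈ P, ∑ K' ∈ P,
        ∫⁻ z, pairedDensity (d := d) σ (rowCorr ρ K) z * pairedDensity σ' (rowCorr ρ K') z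
          ∂(nullLaw n d) := by
        simp_rw [sq, Finset.sum_mul_sum]
        rw [lintegral_finsetSum _ (fun _ _ => by fun_prop)]
        refine Finset.sum_congr rfl fun σ _ => ?_
        rw [lintegral_finsetSum _ (fun _ _ => by fun_prop)]
        refine Finset.sum_congr rfl fun σ' _ => ?_
        rw [lintegral_finsetSum _ (fun _ _ => by fun_prop)]
        refine Finset.sum_congr rfl fun K _ => ?_
        rw [lintegral_finsetSum _ (fun _ _ => by fun_prop)]
    _ ≤ ∑ σ : Equiv.Perm (Fin n), ∑ σ' : Equiv.Perm (Fin n), ∑ K ∈ P, ∑ K' ∈ P,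
        ∑' a : Fin n → ℕ, x ^ (∑ i, a i) *
        (if a ∘ ⇑(σ'⁻¹ * σ) = a then 1 else 0) * (if supp a ⊆ K then 1 else 0) *
        (if supp a ⊆ K' then 1 else 0) := by
        gcongr with σ _ σ' _ K _ K' _
        rw [lintegral_pairedDensity_mul _ _ (abs_rowCorr_lt hρ K) (abs_rowCorr_lt hρ K')]
        exact (cycleIntegral_rowDensity_le hd _ (hc K K' _)).trans
          (cycleIntegral_diagKernel_le _ K K')
    _ = ∑' a : Fin n → ℕ, ∑ σ : Equiv.Perm (Fin n), ∑ σ' : Equiv.Perm (Fin n),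
        ∑ K ∈ P, ∑ K' ∈ P, x ^ (∑ i, a i) *
        (if a ∘ ⇑(σ'⁻¹ * σ) = a then 1 else 0) * (if supp a ⊆ K then 1 else 0) *
        (if supp a ⊆ K' then 1 else 0) := by
        simp_rw [Summable.tsum_finsetSum fun _ _ => ENNReal.summable]
    _ = _ := by
        refine tsum_congr fun a => ?_
        have hN : ∑ K ∈ P, (if supp a ⊆ K then 1 else 0 : ℝ≥0∞) = coverCard k a := by
          rw [Finset.sum_boole, coverCard]
        simp_rw [← Finset.mul_sum, hN, ← Finset.sum_mul, ← Finset.mul_sum, hN, ← Finset.sum_mul,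
          ← Finset.mul_sum, card_filter_perm_pairs]
        ring

lemma stabCard_zero (n : ℕ) : stabCard (0 : Fin n → ℕ) = n.factorial := by
  have : ∀ π : Equiv.Perm (Fin n), (0 : Fin n → ℕ) ∘ π = 0 := fun _ => rfl
  simp [stabCard, this, Fintype.card_perm]

lemma lintegral_altDensity_sq_le {n k d : ℕ} (hn : 1 ≤ n) (hk : k ≤ n) (hd : 1 ≤ d) {ρ : ℝ}
    (hρ : |ρ| < 1) :
    ∫⁻ z, altDensity n k d ρ z ^ 2 ∂(nullLaw n d) ≤
      1 + (k / n : ℝ≥0∞) ^ 2 *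
        (∏ i : Fin k, (1 - ENNReal.ofReal (d * ρ ^ 2) ^ ((i : ℕ) + 1))⁻¹ - 1) := by
  set x := ENNReal.ofReal (d * ρ ^ 2) with hx
  set P := ∏ i : Fin k, (1 - x ^ ((i : ℕ) + 1))⁻¹
  have hf : (n.factorial : ℝ≥0∞) ≠ 0 := by exact_mod_cast n.factorial_ne_zero
  have hf' : (n.factorial : ℝ≥0∞) ≠ ∞ := by simp
  have hC : (n.choose k : ℝ≥0∞) ≠ 0 := by exact_mod_cast (Nat.choose_pos hk).ne'
  have hC' : (n.choose k : ℝ≥0∞) ≠ ∞ := by simp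
  set g : (Fin n → ℕ) → ℝ≥0∞ :=
    fun a => if (supp a).card ≤ k then x ^ (∑ i, a i) * stabCard a else 0 with hg
  set T := ∑' a, if a = 0 then 0 else g a with hT
  have hg0 : g 0 = n.factorial := by simp [hg, supp, stabCard_zero]
  -- The vector `a = 0` contributes exactly `n!` to the sum bounded by `n! * P`; removing it is what
  -- produces the `- 1`.
  have hTP : T / n.factorial ≤ P - 1 := by
    have h := tsum_stabCard_le hk x
    change ∑' a, g a ≤ n.factorial * P at h
    rw [ENNReal.tsum_eq_add_tsum_ite 0, hg0] at h
    replace h : n.factorial + T ≤ n.factorial * P := by convert h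
    refine ENNReal.le_sub_of_add_le_left ENNReal.one_ne_top ?_
    have h' := ENNReal.div_le_of_le_mul' h
    rwa [ENNReal.add_div, ENNReal.div_self hf hf'] at h'
  have hsum : ∑' a : Fin n → ℕ, x ^ (∑ i, a i) *
      (n.factorial * stabCard a) * (coverCard k a : ℝ≥0∞) ^ 2 ≤
      (n.factorial * n.choose k : ℝ≥0∞) ^ 2 * (1 + (k / n : ℝ≥0∞) ^ 2 * (T / n.factorial)) := by
    rw [ENNReal.tsum_eq_add_tsum_ite 0, mul_add]
    refine add_le_add (le_of_eq ?_) ?_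
    · rw [coverCard_zero, stabCard_zero]
      simp
      ring
    · calc _ ≤ ∑' a, (n.factorial * (n.choose k : ℝ≥0∞) ^ 2 * (k / n : ℝ≥0∞) ^ 2) *
            (if a = 0 then 0 else g a) := by
            refine ENNReal.tsum_le_tsum fun a => ?_
            split_ifs with ha
            · simp
            · simp only [hg]
              split_ifs with hs
              · calc _ ≤ x ^ (∑ i, a i) * (n.factorial * stabCard a) *
                      ((k / n : ℝ≥0∞) * n.choose k) ^ 2 := by
                      gcongr
                      exact coverCard_le hn ha
                  _ = _ := by ring
              -- Supports larger than `k` have no cover, so the cut-off in `g` loses nothing.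
              · rw [coverCard_eq_zero (not_le.1 hs)]
                simp
        _ = n.factorial * (n.choose k : ℝ≥0∞) ^ 2 * (k / n : ℝ≥0∞) ^ 2 * T :=
            ENNReal.tsum_mul_left
        _ = n.factorial * (n.choose k : ℝ≥0∞) ^ 2 * (k / n : ℝ≥0∞) ^ 2 *
            (n.factorial * (T / n.factorial)) := by rw [ENNReal.mul_div_cancel hf hf']
        _ = _ := by ring
  have hM : ((n.factorial * n.choose k : ℕ) : ℝ≥0∞) = n.factorial * n.choose k := by push_cast; rfl
  have hM0 : (n.factorial * n.choose k : ℝ≥0∞) ^ 2 ≠ 0 := pow_ne_zero _ (mul_ne_zero hf hC)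
  have hM1 : (n.factorial * n.choose k : ℝ≥0∞) ^ 2 ≠ ∞ :=
    ENNReal.pow_ne_top (ENNReal.mul_ne_top hf' hC')
  unfold altDensity
  simp_rw [mul_pow]
  rw [lintegral_const_mul _ (by fun_prop), hM, ← ENNReal.inv_pow]
  calc _ ≤ ((n.factorial * n.choose k : ℝ≥0∞) ^ 2)⁻¹ * ((n.factorial * n.choose k : ℝ≥0∞) ^ 2 *
        (1 + (k / n : ℝ≥0∞) ^ 2 * (T / n.factorial))) := by
        gcongr
        exact (lintegral_sum_sq_le hd hρ).trans hsum
    _ = 1 + (k / n : ℝ≥0∞) ^ 2 * (T / n.factorial) := by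
        rw [← mul_assoc, ENNReal.inv_mul_cancel hM0 hM1, one_mul]
    _ ≤ _ := by gcongr

lemma mul_sq_lt_one {d : ℕ} {ρ : ℝ} (hd : 1 ≤ d) (hρ : ρ ^ 2 < 1 / (d : ℝ)) :
    (d : ℝ) * ρ ^ 2 < 1 := by
  rwa [lt_div_iff₀ (by exact_mod_cast hd), mul_comm] at hρ

lemma abs_lt_one_of_sq_lt {d : ℕ} {ρ : ℝ} (hd : 1 ≤ d) (hρ : ρ ^ 2 < 1 / (d : ℝ)) : |ρ| < 1 := by
  rw [← sq_lt_one_iff_abs_lt_one]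
  have h1 : (1 : ℝ) ≤ d := by exact_mod_cast hd
  nlinarith [mul_sq_lt_one hd hρ, sq_nonneg ρ]

lemma lintegral_altDensity_sq_le_excess {n k d : ℕ} (hn : 1 ≤ n) (hk : k ≤ n) (hd : 1 ≤ d) {ρ : ℝ}
    (hρ : ρ ^ 2 < 1 / (d : ℝ)) :
    0 ≤ excess n k d ρ ∧ ∫⁻ z, altDensity n k d ρ z ^ 2 ∂(nullLaw n d) ≤
      ENNReal.ofReal (1 + excess n k d ρ) := by
  have hx1 := mul_sq_lt_one hd hρ
  have hx0 : 0 ≤ (d : ℝ) * ρ ^ 2 := by positivity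
  set x := (d : ℝ) * ρ ^ 2 with hx
  have hpos : ∀ i : ℕ, 0 < 1 - x ^ (i + 1) := fun i => by
    have := pow_lt_one₀ hx0 hx1 i.succ_ne_zero
    simp only [Nat.succ_eq_add_one] at this
    linarith
  have hprod : ∏ i ∈ Finset.Icc 1 k, 1 / (1 - x ^ i) = ∏ i : Fin k, (1 - x ^ ((i : ℕ) + 1))⁻¹ := by
    rw [Fin.prod_univ_eq_prod_range (fun i => (1 - x ^ (i + 1))⁻¹), Finset.range_eq_Ico,
      Finset.prod_Ico_add' (fun i => (1 - x ^ i)⁻¹)]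
    simp only [one_div]
    rfl
  have hP : ∏ i : Fin k, (1 - ENNReal.ofReal x ^ ((i : ℕ) + 1))⁻¹ =
      ENNReal.ofReal (∏ i : Fin k, (1 - x ^ ((i : ℕ) + 1))⁻¹) := by
    rw [ENNReal.ofReal_prod_of_nonneg (f := fun i : Fin k => (1 - x ^ ((i : ℕ) + 1))⁻¹)
      fun i _ => (inv_pos.2 (hpos i)).le]
    refine Finset.prod_congr rfl fun i _ => ?_
    rw [ENNReal.ofReal_inv_of_pos (hpos i), ENNReal.ofReal_sub _ (by positivity),
      ENNReal.ofReal_pow hx0, ENNReal.ofReal_one]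
  have hP1 : 1 ≤ ∏ i : Fin k, (1 - x ^ ((i : ℕ) + 1))⁻¹ :=
    Finset.one_le_prod fun i _ => (one_le_inv₀ (hpos i)).2 (by
      have : 0 ≤ x ^ ((i : ℕ) + 1) := by positivity
      linarith)
  have hkn : (k / n : ℝ≥0∞) = ENNReal.ofReal ((k : ℝ) / n) := by
    rw [ENNReal.ofReal_div_of_pos (by exact_mod_cast hn)]; simp
  have hex : 0 ≤ excess n k d ρ := by
    rw [excess, hprod]
    exact mul_nonneg (by positivity) (by linarith)
  refine ⟨hex, (lintegral_altDensity_sq_le hn hk hd (abs_lt_one_of_sq_lt hd hρ)).trans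
    (le_of_eq ?_)⟩
  rw [hP, ENNReal.ofReal_add zero_le_one hex, excess, hprod, ENNReal.ofReal_mul (by positivity),
    ENNReal.ofReal_sub _ zero_le_one, ENNReal.ofReal_one, hkn, ENNReal.ofReal_pow (by positivity)]

lemma isProbabilityMeasure_altLaw {n k d : ℕ} (hk : k ≤ n) (ρ : ℝ) :
    IsProbabilityMeasure (altLaw n k d ρ) := by
  constructor
  have h0 : ((n.factorial * n.choose k : ℕ) : ℝ≥0∞) ≠ 0 := by
    exact_mod_cast (Nat.mul_pos n.factorial_pos (Nat.choose_pos hk)).ne'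
  have h : ∀ (σ : Equiv.Perm (Fin n)) (K : Finset (Fin n)),
      condAltLaw n d ρ σ K Set.univ = 1 := fun σ K => by
    unfold condAltLaw; exact measure_univ
  rw [altLaw, Measure.smul_apply, Measure.finsetSum_apply]
  simp only [Measure.finsetSum_apply, h, Finset.sum_const, Finset.card_univ, Fintype.card_perm,
    Fintype.card_fin, Finset.card_powersetCard, nsmul_eq_mul, mul_one, smul_eq_mul]
  rw [← Nat.cast_mul, ENNReal.inv_mul_cancel h0 (ENNReal.natCast_ne_top _)]

/-! ### From the second moment to the optimal risk. -/

/-- If the density of a probability measure `ν` has second moment at most `1 + e`, then `μ` exceeds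
`ν` by at most `t + e / (4 t)` on any event. -/
lemma real_le_add_of_lintegral_sq_le {α : Type*} [MeasurableSpace α] {μ : Measure α}
    [IsProbabilityMeasure μ] {L : α → ℝ≥0∞} (hL : Measurable L)
    (h1 : IsProbabilityMeasure (μ.withDensity L)) {e : ℝ} (he : 0 ≤ e)
    (h2 : ∫⁻ z, L z ^ 2 ∂μ ≤ ENNReal.ofReal (1 + e)) {A : Set α} (hA : MeasurableSet A) {t : ℝ}
    (ht : 0 < t) :
    μ.real A ≤ (μ.withDensity L).real A + (t + e / (4 * t)) := by
  have hint1 : ∫⁻ z, L z ∂μ = 1 := by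
    rw [← setLIntegral_univ, ← withDensity_apply _ MeasurableSet.univ, measure_univ]
  have hfin : ∀ᵐ z ∂μ, L z < ∞ := ae_lt_top hL (by rw [hint1]; exact ENNReal.one_ne_top)
  set l : α → ℝ := fun z => (L z).toReal with hl
  have hl1 : Integrable l μ := integrable_toReal_of_lintegral_ne_top hL.aemeasurable
    (by rw [hint1]; exact ENNReal.one_ne_top)
  have hsq : ∫⁻ z, L z ^ 2 ∂μ ≠ ∞ := (h2.trans_lt ENNReal.ofReal_lt_top).ne
  have hl2 : Integrable (fun z => l z ^ 2) μ := by
    have := integrable_toReal_of_lintegral_ne_top (hL.pow_const 2).aemeasurable hsq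
    simpa [hl, ENNReal.toReal_pow] using this
  have hI1 : ∫ z, l z ∂μ = 1 := by
    rw [hl, integral_toReal hL.aemeasurable hfin, hint1, ENNReal.toReal_one]
  have hI2 : ∫ z, l z ^ 2 ∂μ ≤ 1 + e := by
    have h3 : ∫ z, (L z ^ 2).toReal ∂μ = (∫⁻ z, L z ^ 2 ∂μ).toReal :=
      integral_toReal (hL.pow_const 2).aemeasurable
        (hfin.mono fun z hz => ENNReal.pow_lt_top hz)
    simp only [ENNReal.toReal_pow] at h3
    rw [hl, h3]
    exact ENNReal.toReal_le_of_le_ofReal (by linarith) h2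
  have hA1 : (μ.withDensity L).real A = ∫ z in A, l z ∂μ := by
    rw [measureReal_def, withDensity_apply _ hA, hl,
      integral_toReal hL.aemeasurable (ae_restrict_of_ae hfin)]
  have hA0 : μ.real A = ∫ z in A, (1 : ℝ) ∂μ := by simp
  -- This is `t + u ^ 2 / (4 * t)` with `u = 1 - l z`, which dominates `u` by AM-GM. As `q ≥ 0`, its
  -- integral over `A` is at most that over the whole space, where `∫ u ^ 2 ≤ e`.
  set q : α → ℝ := fun z => t + (l z ^ 2 - 2 * l z + 1) / (4 * t) with hq
  have hi1 : Integrable (fun z => l z ^ 2 - 2 * l z) μ := hl2.sub (hl1.const_mul 2)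
  have hi2 : Integrable (fun z => (l z ^ 2 - 2 * l z + 1) / (4 * t)) μ :=
    (hi1.add (integrable_const 1)).div_const _
  have hqi : Integrable q μ := (integrable_const t).add hi2
  have hq_ge : ∀ z, 1 - l z ≤ q z := fun z => by
    have : q z - (1 - l z) = (2 * t - (1 - l z)) ^ 2 / (4 * t) := by
      simp only [hq]; field_simp; ring
    have h4 : 0 ≤ (2 * t - (1 - l z)) ^ 2 / (4 * t) := by positivity
    linarith
  have hq0 : ∀ z, 0 ≤ q z := fun z => by
    have : q z = t + (l z - 1) ^ 2 / (4 * t) := by simp only [hq]; ring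
    rw [this]; positivity
  have hqI : ∫ z, q z ∂μ ≤ t + e / (4 * t) := by
    have h5 : ∫ z, q z ∂μ = t + (∫ z, l z ^ 2 ∂μ - 2 * ∫ z, l z ∂μ + 1) / (4 * t) := by
      rw [integral_add (integrable_const _) hi2, integral_div,
        integral_add hi1 (integrable_const 1), integral_sub hl2 (hl1.const_mul 2),
        integral_const_mul]
      simp
    rw [h5, hI1]
    gcongr
    linarith
  have key : μ.real A - (μ.withDensity L).real A ≤ ∫ z, q z ∂μ := by
    rw [hA0, hA1, ← integral_sub (integrable_const _).integrableOn hl1.integrableOn]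
    exact (setIntegral_mono ((integrable_const _).sub hl1).integrableOn hqi.integrableOn
      hq_ge).trans (setIntegral_le_integral hqi (ae_of_all _ hq0))
  linarith

lemma bddBelow_risk (n k d : ℕ) (ρ : ℝ) :
    BddBelow (Set.range fun φ : {φ : Databases n d → Fin 2 // Measurable φ} =>
      risk n k d ρ φ.1) :=
  ⟨0, by rintro _ ⟨φ, rfl⟩; exact add_nonneg measureReal_nonneg measureReal_nonneg⟩

lemma optimalRisk_le_one (n k d : ℕ) (ρ : ℝ) : optimalRisk n k d ρ ≤ 1 := by
  refine (ciInf_le (bddBelow_risk n k d ρ) ⟨fun _ => 1, measurable_const⟩).trans ?_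
  simp [risk]

/-- With `A = {φ = 0}` the risk is `1` minus the excess of the null probability of `A` over its
probability under the alternative. -/
lemma one_sub_le_optimalRisk {n k d : ℕ} (hn : 1 ≤ n) (hk : k ≤ n) (hd : 1 ≤ d) {ρ : ℝ}
    (hρ : ρ ^ 2 < 1 / (d : ℝ)) {t : ℝ} (ht : 0 < t) :
    1 - (t + excess n k d ρ / (4 * t)) ≤ optimalRisk n k d ρ := by
  have : Nonempty {φ : Databases n d → Fin 2 // Measurable φ} := ⟨⟨fun _ => 1, measurable_const⟩⟩
  refine le_ciInf fun ⟨φ, hφ⟩ => ?_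
  obtain ⟨he, hsq⟩ := lintegral_altDensity_sq_le_excess hn hk hd hρ
  have halt := altLaw_eq_withDensity (n := n) (k := k) (d := d) (abs_lt_one_of_sq_lt hd hρ)
  have hprob := isProbabilityMeasure_altLaw (d := d) hk ρ
  rw [halt] at hprob
  have hA : MeasurableSet {z | φ z = 0} := hφ (measurableSet_singleton 0)
  have h := real_le_add_of_lintegral_sq_le (by fun_prop) hprob he hsq hA ht
  have hc : {z | φ z = 1} = {z | φ z = 0}ᶜ := by
    ext z
    simp only [Set.mem_ofPred_eq, Set.mem_compl_iff]
    generalize φ z = b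
    fin_cases b <;> simp
  simp only [risk]
  rw [hc, probReal_compl_eq_one_sub hA, halt]
  linarith

end CorrelatedDatabases

end

open CorrelatedDatabases in
theorem theorem6 :
    (∀ (n k d : ℕ) (ρ : ℝ), 1 ≤ n → k ≤ n → 1 ≤ d → ρ ^ 2 < 1 / (d : ℝ) →
      altLaw n k d ρ ≪ nullLaw n d ∧
      ∫⁻ z, likelihoodRatio n k d ρ z ^ 2 ∂(nullLaw n d) ≤
        ENNReal.ofReal (1 + excess n k d ρ)) ∧
    (∀ (n k d : ℕ → ℕ) (ρ : ℕ → ℝ),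
      (∀ l, 1 ≤ n l) → (∀ l, k l ≤ n l) → (∀ l, 1 ≤ d l) →
      (∀ l, ρ l ^ 2 < 1 / (d l : ℝ)) →
      Tendsto (fun l => excess (n l) (k l) (d l) (ρ l)) atTop (𝓝 0) →
      Tendsto (fun l => optimalRisk (n l) (k l) (d l) (ρ l)) atTop (𝓝 1) ∧
      ¬ AdmissibleForWeakDetection n k d ρ) := by
  refine ⟨fun n k d ρ hn hk hd hρ => ?_, fun n k d ρ hn hk hd hρ hlim => ?_⟩
  · have halt := altLaw_eq_withDensity (n := n) (k := k) (d := d) (abs_lt_one_of_sq_lt hd hρ)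
    refine ⟨halt ▸ withDensity_absolutelyContinuous _ _, ?_⟩
    have hae : likelihoodRatio n k d ρ =ᵐ[nullLaw n d] altDensity n k d ρ := by
      rw [likelihoodRatio, halt]
      exact Measure.rnDeriv_withDensity _ (measurable_altDensity n k d ρ)
    have hsq : (fun z => likelihoodRatio n k d ρ z ^ 2) =ᵐ[nullLaw n d]
        fun z => altDensity n k d ρ z ^ 2 := hae.mono fun z hz => by simp only [hz]
    rw [lintegral_congr_ae hsq]
    exact (lintegral_altDensity_sq_le_excess hn hk hd hρ).2
  · have ht : Tendsto (fun l => optimalRisk (n l) (k l) (d l) (ρ l)) atTop (𝓝 1) := by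
      rw [Metric.tendsto_nhds]
      intro ε hε
      -- Taking `t = ε / 2`, the bound `(ε / 2) ^ 2` on the excess makes `excess / (4 * t)` smaller
      -- than `ε / 8`.
      filter_upwards [hlim.eventually_lt_const (show (0 : ℝ) < (ε / 2) ^ 2 by positivity)]
        with l hl
      have h1 := one_sub_le_optimalRisk (hn l) (hk l) (hd l) (hρ l) (half_pos hε)
      have h2 := optimalRisk_le_one (n l) (k l) (d l) (ρ l)
      have h3 : excess (n l) (k l) (d l) (ρ l) / (4 * (ε / 2)) < ε / 2 := by
        rw [div_lt_iff₀ (by positivity)]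
        nlinarith
      rw [Real.dist_eq, abs_lt]
      constructor <;> linarith
    refine ⟨ht, ?_⟩
    rw [AdmissibleForWeakDetection, ht.limsup_eq]
    exact lt_irrefl 1
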